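/- Let $\mathsf{Top}$ be the category of topological spaces and continuous maps. For a space $X$ let $\mathscr{V}X$ be the set of all compact subsets of $X$ (including $\emptyset$) with the topology that has as a subbase the sets $\{R : R\cap U\neq\emptyset\}$ and $\{R : R\subseteq U\}$, where $U$ ranges over the open subsets of $X$; for a continuous map $f\colon X\to Y$ let $\mathscr{V}f\colon \mathscr{V}X\to\mathscr{V}Y$ be given by $R\mapsto f[R]$. This defines the Vietoris functor $\mathscr{V}\colon\mathsf{Top}\to\mathsf{Top}$. The Vietoris polynomial functors are the endofunctors of $\mathsf{Top}$ built, up to natural isomorphism, according to the grammar $$F ::= \mathscr{V} \mid A \mid \mathsf{Id} \mid \prod_{i\in I}F_i \mid \coprod_{i\in I}F_i \mid FF,$$ where $A$ ranges over all topological spaces (interpreted as constant functors), $I$ is an arbitrary index set, products and coproducts are formed pointwise in $\mathsf{Top}$, and $FF$ denotes composition. Let $F\colon\mathsf{Top}\to\mathsf{Top}$ be a Vietoris polynomial functor, and assume that all constants $A$ used in building $F$ are Hausdorff spaces. Then $F$ has an initial algebra, that is, the category of $F$-algebras (spaces $X$ with a continuous map $FX\to X$, and continuous maps commuting with these structure maps)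 has an initial object. -/

import Mathlib

open CategoryTheory CategoryTheory.Limits TopologicalSpace

universe u

/-- The Vietoris functor on topological spaces. It sends a space `X` to the space of all compact
subsets of `X` (the empty set included) with the hit-and-miss topology, which has as a subbase the
sets `{R | (R ∩ U).Nonempty}` and `{R | R ⊆ U}` for `U` open in `X`; it sends a continuous map `f`
to `R ↦ f '' R`. -/
def vietorisFunctor : TopCat.{u} ⥤ TopCat.{u} where
  obj X := TopCat.of (Compacts X)
  map f := TopCat.ofHom
    ⟨Compacts.map f.hom f.hom.continuous, f.hom.continuous.compacts_map⟩
  map_id X := by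
    refine TopCat.hom_ext (ContinuousMap.ext fun K => ?_)
    exact Compacts.map_id K
  map_comp f g := by
    refine TopCat.hom_ext (ContinuousMap.ext fun K => ?_)
    exact Compacts.map_comp g.hom f.hom g.hom.continuous f.hom.continuous K

/-- The product of a family of endofunctors of the category of topological spaces, computed
pointwise: `X ↦ ∏ i, F i X` with the product topology. -/
def topProdFunctor {I : Type u} (F : I → TopCat.{u} ⥤ TopCat.{u}) : TopCat.{u} ⥤ TopCat.{u} where
  obj X := TopCat.of (∀ i, (F i).obj X)
  map f := TopCat.ofHom
    ⟨fun x i => ((F i).map f).hom (x i),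
      continuous_pi fun i => ((F i).map f).hom.continuous.comp (continuous_apply i)⟩
  map_id X := by
    refine TopCat.hom_ext (ContinuousMap.ext fun x => funext fun i => ?_)
    change ((F i).map (𝟙 X)).hom (x i) = x i
    simp
  map_comp f g := by
    refine TopCat.hom_ext (ContinuousMap.ext fun x => funext fun i => ?_)
    change ((F i).map (f ≫ g)).hom (x i) = ((F i).map g).hom (((F i).map f).hom (x i))
    simp

/-- The coproduct of a family of endofunctors of the category of topological spaces, computed
pointwise: `X ↦ ∐ i, F i X`, the disjoint union with the sum topology. -/
def topCoprodFunctor {I : Type u} (F : I → TopCat.{u} ⥤ TopCat.{u}) :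
    TopCat.{u} ⥤ TopCat.{u} where
  obj X := TopCat.of (Σ i, (F i).obj X)
  map f := TopCat.ofHom
    ⟨fun x => ⟨x.1, ((F x.1).map f).hom x.2⟩,
      continuous_sigma fun i => continuous_sigmaMk.comp ((F i).map f).hom.continuous⟩
  map_id X := by
    refine TopCat.hom_ext (ContinuousMap.ext fun x => Sigma.ext rfl (heq_of_eq ?_))
    change ((F x.1).map (𝟙 X)).hom x.2 = x.2
    simp
  map_comp f g := by
    refine TopCat.hom_ext (ContinuousMap.ext fun x => Sigma.ext rfl (heq_of_eq ?_))
    change ((F x.1).map (f ≫ g)).hom x.2 = ((F x.1).map g).hom (((F x.1).map f).hom x.2)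
    simp

/-- Expressions of the grammar
`F ::= 𝒱 | A | Id | ∏ i, F i | ∐ i, F i | F F`,
where `A` ranges over all topological spaces and the index sets are arbitrary. -/
inductive VietorisExpr : Type (u + 1)
  | vietoris : VietorisExpr
  | const (A : TopCat.{u}) : VietorisExpr
  | ident : VietorisExpr
  | prod (I : Type u) (F : I → VietorisExpr) : VietorisExpr
  | coprod (I : Type u) (F : I → VietorisExpr) : VietorisExpr
  | comp (F G : VietorisExpr) : VietorisExpr

namespace VietorisExpr

/-- The endofunctor denoted by an expression (determined up to natural isomorphism, as products
and coproducts are); `comp F G` denotes `X ↦ F (G X)`. -/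
def toFunctor : VietorisExpr.{u} → (TopCat.{u} ⥤ TopCat.{u})
  | vietoris => vietorisFunctor
  | const A => (Functor.const TopCat.{u}).obj A
  | ident => 𝟭 TopCat.{u}
  | prod _ F => topProdFunctor fun i => (F i).toFunctor
  | coprod _ F => topCoprodFunctor fun i => (F i).toFunctor
  | comp F G => G.toFunctor ⋙ F.toFunctor

/-- All constants that occur in the expression are Hausdorff spaces. -/
def HausdorffConstants : VietorisExpr.{u} → Prop
  | vietoris => True
  | const A => T2Space A
  | ident => True
  | prod _ F => ∀ i, (F i).HausdorffConstants
  | coprod _ F => ∀ i, (F i).HausdorffConstants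
  | comp F G => F.HausdorffConstants ∧ G.HausdorffConstants

end VietorisExpr

/-!
The initial algebra is found inside a pre-fixed point: a space `L` with a continuous injection
`F L → L`.

For `L` take the limit of the terminal chain `1 ← F 1 ← F (F 1) ← ⋯`. It carries the initial
topology of its projections (`IsInitialTower`), and Vietoris polynomial functors preserve sequential
cones with initial topology (`VietorisExpr.isInitialTower_map`). The essential case is the Vietoris
functor: an open set of `X` is an increasing union of preimages of open sets of the stages, and a
compact set inside this union lies in one of them (`iInf_induced_compacts_le`). Hence `F L` has the
initial topology for its maps to the spaces `F (Fⁿ 1)`. Hausdorff constants make `F L` a Hausdorff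
space, so these maps are jointly injective and the canonical map `F L → L` is injective
(`mono_terminalChainLimitStr`).

Given a functor preserving injections and an injection `m : F A → A`, consider the subsets of `A`
with a topology finer than the subspace topology (`FinerSubspace`), and among them those that carry
a recursive coalgebra: one with a unique coalgebra-to-algebra morphism into each algebra. They are
closed under `F`, which enlarges them, and under unions of chains, since the union of a chain with
its finest topology is a colimit of spaces (`FinerSubspace.exists_union_desc`). By Zorn's lemma
there is a maximal one, which is a fixed point of `F`, and a recursive coalgebra with invertible
structure is an initial algebra (`hasInitial_algebra_of_mono`).
-/

open Function Topology

/-! ### Recursive coalgebras -/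

section Recursive

open Endofunctor

variable {C : Type*} [Category C] {F : C ⥤ C}

/-- A coalgebra `c : X ⟶ F X` is recursive if every algebra `B` receives exactly one
coalgebra-to-algebra morphism from it, that is, exactly one solution of `h = c ≫ F h ≫ b`. -/
def IsRecursive {X : C} (c : X ⟶ F.obj X) : Prop :=
  ∀ B : Algebra F, ∃! h : X ⟶ B.a, h = c ≫ F.map h ≫ B.str

/-- If `h` is the solution for `c`, the one for `F c` is `F h ≫ b`; conversely a solution `g` for
`F c` yields the solution `c ≫ g` for `c`, which determines `g`. -/
theorem IsRecursive.map {X : C} {c : X ⟶ F.obj X} (hc : IsRecursive c) :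
    IsRecursive (F.map c) := by
  intro B
  obtain ⟨h, hh, huniq⟩ := hc B
  refine ⟨F.map h ≫ B.str, ?_, fun g hg => ?_⟩
  · dsimp only
    conv_lhs => rw [hh]
    simp only [Functor.map_comp, Category.assoc]
  · dsimp only at hg
    have hcg : c ≫ g = h := huniq _ <| by
      dsimp only
      conv_lhs => rw [hg]
      simp only [Functor.map_comp, Category.assoc]
    rw [← hcg, Functor.map_comp, Category.assoc]
    exact hg

theorem IsRecursive.of_iso {X Y : C} {c : X ⟶ F.obj X} (hc : IsRecursive c) (e : Y ≅ X) :
    IsRecursive (e.hom ≫ c ≫ F.map e.inv) := by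
  intro B
  obtain ⟨h, hh, huniq⟩ := hc B
  refine ⟨e.hom ≫ h, ?_, fun g hg => ?_⟩
  · dsimp only
    rw [Functor.map_comp]
    simp only [Category.assoc, Iso.map_inv_hom_id_assoc]
    rw [← hh]
  · dsimp only at hg
    rw [← Iso.inv_comp_eq]
    refine huniq _ ?_
    dsimp only
    conv_lhs => rw [hg]
    simp

/-- A recursive coalgebra with invertible structure is an initial algebra. -/
theorem IsRecursive.hasInitial {X : C} {c : X ⟶ F.obj X} (hc : IsRecursive c) (k : F.obj X ⟶ X)
    (hck : c ≫ k = 𝟙 X) (hkc : k ≫ c = 𝟙 (F.obj X)) : HasInitial (Algebra F) := by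
  refine IsInitial.hasInitial (X := (⟨X, k⟩ : Algebra F)) <|
    IsInitial.ofUniqueHom (fun B => ⟨(hc B).choose, ?_⟩) fun B g => Algebra.ext ?_
  · have h := (hc B).choose_spec.1
    dsimp only at h ⊢
    conv_rhs => rw [h]
    rw [reassoc_of% hkc]
  · refine (hc B).choose_spec.2 g.f ?_
    dsimp only
    rw [g.h, reassoc_of% hck]

end Recursive

/-! ### Finer subspaces and unions of chains -/

/-- A subset of the space `A` with a topology at least as fine as the subspace topology. Up to
isomorphism these are the monomorphisms into `A` in the category of topological spaces. -/
structure FinerSubspace (A : TopCat.{u}) : Type u where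
  /-- The underlying set. -/
  carrier : Set A
  /-- The topology on the underlying set. -/
  top : TopologicalSpace carrier
  continuous_val : Continuous[top, _] (Subtype.val : carrier → A)

namespace FinerSubspace

variable {A : TopCat.{u}}

/-- The topological space given by a finer subspace. -/
def obj (S : FinerSubspace A) : TopCat.{u} := @TopCat.of S.carrier S.top

/-- The inclusion of a finer subspace. -/
def ι (S : FinerSubspace A) : S.obj ⟶ A :=
  @TopCat.ofHom S.carrier A S.top _ (@ContinuousMap.mk _ _ S.top _ _ S.continuous_val)

theorem ι_injective (S : FinerSubspace A) : Injective S.ι :=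
  Subtype.val_injective

instance (S : FinerSubspace A) : Mono S.ι :=
  (TopCat.mono_iff_injective _).2 S.ι_injective

/-- `S ≤ T` if the inclusion of `S` factors continuously through `T`. -/
instance : Preorder (FinerSubspace A) where
  le S T := ∃ f : S.obj ⟶ T.obj, f ≫ T.ι = S.ι
  le_refl S := ⟨𝟙 _, Category.id_comp _⟩
  le_trans _ _ _ := fun ⟨f, hf⟩ ⟨g, hg⟩ => ⟨f ≫ g, by rw [Category.assoc, hg, hf]⟩

/-- Every monomorphism into `A` is isomorphic to the inclusion of a finer subspace. -/
theorem exists_iso_of_mono {X : TopCat.{u}} (j : X ⟶ A) [Mono j] :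
    ∃ (S : FinerSubspace A) (e : S.obj ≅ X), e.hom ≫ j = S.ι := by
  have hj : Injective j := (TopCat.mono_iff_injective j).1 inferInstance
  let e : Set.range j ≃ X := (Equiv.ofInjective j hj).symm
  have he (x : Set.range j) : j (e x) = x.1 := Equiv.apply_ofInjective_symm hj x
  let t : TopologicalSpace (Set.range j) := TopologicalSpace.induced e inferInstance
  let eh : Set.range j ≃ₜ X := e.toHomeomorphOfIsInducing ⟨rfl⟩
  refine ⟨⟨Set.range j, t, ?_⟩, TopCat.isoOfHomeo eh, ?_⟩
  · convert j.hom.continuous.comp eh.continuous using 1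
    exact funext fun x => (he x).symm
  · exact TopCat.hom_ext (ContinuousMap.ext he)

/-- The union of a family of finer subspaces, with the finest topology that makes all the
inclusions into the union continuous. -/
def union (c : Set (FinerSubspace A)) : FinerSubspace A where
  carrier := ⋃ S ∈ c, S.carrier
  top := ⨆ S : c, S.1.top.coinduced fun a => ⟨a.1, Set.mem_biUnion S.2 a.2⟩
  continuous_val := continuous_iSup_dom.2 fun S => by
    rw [@continuous_coinduced_dom _ _ _ _ _ S.1.top]
    exact S.1.continuous_val

/-- The inclusion of a member of a family into its union. -/
def toUnion {c : Set (FinerSubspace A)} {S : FinerSubspace A} (hS : S ∈ c) :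
    S.obj ⟶ (union c).obj :=
  @TopCat.ofHom S.carrier (union c).carrier S.top (union c).top <|
    @ContinuousMap.mk _ _ S.top (union c).top (fun a => ⟨a.1, Set.mem_biUnion hS a.2⟩) <|
      continuous_iff_coinduced_le.2 <| le_iSup
        (fun S : c => S.1.top.coinduced fun a =>
          (⟨a.1, Set.mem_biUnion S.2 a.2⟩ : (union c).carrier)) ⟨S, hS⟩

theorem toUnion_ι {c : Set (FinerSubspace A)} {S : FinerSubspace A} (hS : S ∈ c) :
    toUnion hS ≫ (union c).ι = S.ι :=
  rfl

theorem le_union {c : Set (FinerSubspace A)} {S : FinerSubspace A} (hS : S ∈ c) : S ≤ union c :=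
  ⟨toUnion hS, rfl⟩

theorem union_hom_ext {c : Set (FinerSubspace A)} {Y : TopCat.{u}} {g h : (union c).obj ⟶ Y}
    (H : ∀ S (hS : S ∈ c), toUnion hS ≫ g = toUnion hS ≫ h) : g = h := by
  refine TopCat.hom_ext (ContinuousMap.ext ?_)
  rintro ⟨a, h⟩
  obtain ⟨S, hS, ha⟩ := Set.mem_iUnion₂.1 h
  exact ConcreteCategory.congr_hom (H S hS) (⟨a, ha⟩ : S.carrier)

/-- The union of a chain of finer subspaces is its colimit. -/
theorem exists_union_desc {c : Set (FinerSubspace A)} (hc : IsChain (· ≤ ·) c) {Y : TopCat.{u}}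
    (k : ∀ S ∈ c, S.obj ⟶ Y)
    (hk : ∀ S (hS : S ∈ c) T (hT : T ∈ c) (f : S.obj ⟶ T.obj), f ≫ T.ι = S.ι →
      f ≫ k T hT = k S hS) :
    ∃ h : (union c).obj ⟶ Y, ∀ S (hS : S ∈ c), toUnion hS ≫ h = k S hS := by
  have key : ∀ S (hS : S ∈ c) T (hT : T ∈ c) (a : A) (haS : a ∈ S.carrier) (haT : a ∈ T.carrier),
      k S hS (⟨a, haS⟩ : S.carrier) = k T hT (⟨a, haT⟩ : T.carrier) := by
    have aux : ∀ S (hS : S ∈ c) T (hT : T ∈ c), S ≤ T → ∀ (a : A) (haS : a ∈ S.carrier)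
        (haT : a ∈ T.carrier),
        k S hS (⟨a, haS⟩ : S.carrier) = k T hT (⟨a, haT⟩ : T.carrier) := by
      rintro S hS T hT ⟨f, hf⟩ a haS haT
      rw [← hk S hS T hT f hf]
      have : f (⟨a, haS⟩ : S.carrier) = (⟨a, haT⟩ : T.carrier) :=
        T.ι_injective (ConcreteCategory.congr_hom hf (⟨a, haS⟩ : S.carrier))
      exact congrArg (k T hT) this
    intro S hS T hT a haS haT
    rcases hc.total hS hT with h | h
    · exact aux S hS T hT h a haS haT
    · exact (aux T hT S hS h a haT haS).symm
  choose s hs hs' using fun a : (union c).carrier => Set.mem_iUnion₂.1 a.2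
  let φ : (union c).carrier → Y := fun a => k (s a) (hs a) (⟨a.1, hs' a⟩ : (s a).carrier)
  have hφ (S) (hS : S ∈ c) (a : S.carrier) : φ ⟨a.1, Set.mem_biUnion hS a.2⟩ = k S hS a :=
    key _ _ _ _ _ _ _
  have hcont : Continuous[(union c).top, _] φ := by
    refine continuous_iSup_dom.2 fun S => ?_
    refine (@continuous_coinduced_dom S.1.carrier (union c).carrier Y _ φ S.1.top _).2 ?_
    exact (continuous_congr (X := S.1.obj) (hφ S.1 S.2)).2 (k S.1 S.2).hom.continuous
  exact ⟨@TopCat.ofHom _ _ (union c).top _ (@ContinuousMap.mk _ _ (union c).top _ φ hcont),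
    fun S hS => TopCat.hom_ext (ContinuousMap.ext (hφ S hS))⟩

end FinerSubspace

/-! ### Initial algebras from pre-fixed points -/

section PrefixedPoint

open Endofunctor FinerSubspace

variable {F : TopCat.{u} ⥤ TopCat.{u}} {A : TopCat.{u}}

/-- A finer subspace `S` of the algebra `m : F A ⟶ A` that carries a recursive coalgebra whose
structure commutes with the inclusions of `S` and `F S` into `A`. -/
def IsRecursiveSubspace (m : F.obj A ⟶ A) (S : FinerSubspace A) : Prop :=
  ∃ c : S.obj ⟶ F.obj S.obj, c ≫ F.map S.ι ≫ m = S.ι ∧ IsRecursive c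

variable [F.PreservesMonomorphisms] (m : F.obj A ⟶ A) [Mono m]

/-- If `S` is a recursive subspace, so is (a copy of) `F S`. -/
theorem IsRecursiveSubspace.exists_map {S : FinerSubspace A} (hS : IsRecursiveSubspace m S) :
    ∃ (T : FinerSubspace A) (e : T.obj ≅ F.obj S.obj), e.hom ≫ F.map S.ι ≫ m = T.ι ∧
      S ≤ T ∧ IsRecursiveSubspace m T := by
  obtain ⟨c, hc, hrec⟩ := hS
  obtain ⟨T, e, he⟩ := exists_iso_of_mono (F.map S.ι ≫ m)
  refine ⟨T, e, he, ⟨c ≫ e.inv, by rw [← he]; simpa using hc⟩,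
    e.hom ≫ F.map c ≫ F.map e.inv, ?_, hrec.map.of_iso e⟩
  rw [← he]
  simp only [Category.assoc, Functor.map_comp, Iso.map_inv_hom_id_assoc]
  rw [← Functor.map_comp_assoc F c, ← Functor.map_comp_assoc, Category.assoc, hc]

/-- The union of a chain of recursive subspaces is recursive: the solutions on the members of the
chain agree by uniqueness, and glue since the union is a colimit. -/
theorem isRecursiveSubspace_union {s : Set (FinerSubspace A)} (hs : IsChain (· ≤ ·) s)
    (hrec : ∀ S ∈ s, IsRecursiveSubspace m S) : IsRecursiveSubspace m (union s) := by
  choose c hc hrec using hrec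
  -- Factorizations between members of the chain are coalgebra morphisms, `A` being a mono target.
  have hcoalg : ∀ S (hS : S ∈ s) T (hT : T ∈ s) (f : S.obj ⟶ T.obj), f ≫ T.ι = S.ι →
      f ≫ c T hT = c S hS ≫ F.map f := by
    intro S hS T hT f hf
    rw [← cancel_mono (F.map T.ι ≫ m), Category.assoc, hc T hT, hf, Category.assoc,
      ← Functor.map_comp_assoc, hf, hc S hS]
  obtain ⟨d, hd⟩ := exists_union_desc hs (fun S hS => c S hS ≫ F.map (toUnion hS)) <| by
    intro S hS T hT f hf
    rw [← Category.assoc, hcoalg S hS T hT f hf, Category.assoc, ← Functor.map_comp]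
    congr 2
    rw [← cancel_mono (union s).ι, Category.assoc, toUnion_ι, toUnion_ι, hf]
  refine ⟨d, union_hom_ext fun S hS => ?_, fun B => ?_⟩
  · rw [← Category.assoc, hd, Category.assoc, ← Functor.map_comp_assoc, toUnion_ι, hc]
  · choose h hh huniq using fun S hS => hrec S hS B
    dsimp only at hh huniq
    obtain ⟨g, hg⟩ := exists_union_desc hs h <| by
      intro S hS T hT f hf
      refine huniq S hS _ ?_
      conv_lhs => rw [hh T hT]
      rw [← Category.assoc, hcoalg S hS T hT f hf, Category.assoc, ← Functor.map_comp_assoc]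
    refine ⟨g, union_hom_ext fun S hS => ?_, fun g' hg' => union_hom_ext fun S hS => ?_⟩
    · rw [hg, ← Category.assoc, hd, Category.assoc, ← Functor.map_comp_assoc, hg]
      exact hh S hS
    · dsimp only at hg'
      rw [hg]
      refine huniq S hS _ ?_
      conv_lhs => rw [hg']
      rw [← Category.assoc, hd, Category.assoc, ← Functor.map_comp_assoc]

/-- An endofunctor of the category of topological spaces that preserves monomorphisms and has a
pre-fixed point `m : F A ↣ A` has an initial algebra, carried by a maximal recursive subspace
of `A`. -/
theorem hasInitial_algebra_of_mono {F : TopCat.{u} ⥤ TopCat.{u}} [F.PreservesMonomorphisms]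
    {A : TopCat.{u}} (m : F.obj A ⟶ A) [Mono m] : HasInitial (Algebra F) := by
  obtain ⟨S, hS⟩ : ∃ S : {S : FinerSubspace A // IsRecursiveSubspace m S}, IsMax S := by
    refine zorn_le fun s hs => ?_
    have hs' : IsChain (· ≤ ·) (Subtype.val '' s) := by
      rintro _ ⟨S, hS, rfl⟩ _ ⟨T, hT, rfl⟩ hne
      exact hs hS hT fun h => hne (congrArg _ h)
    refine ⟨⟨union (Subtype.val '' s), isRecursiveSubspace_union m hs' ?_⟩, fun S hS =>
      le_union (Set.mem_image_of_mem _ hS)⟩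
    rintro _ ⟨S, -, rfl⟩
    exact S.2
  -- By maximality the copy `T` of `F S` is below `S`, which gives the inverse `F S ⟶ S` of `c`.
  obtain ⟨T, e, he, hST, hT⟩ := S.2.exists_map
  obtain ⟨f, hf⟩ : T ≤ S.1 := hS (b := ⟨T, hT⟩) hST
  obtain ⟨c, hc, hrec⟩ := S.2
  have hk : (e.inv ≫ f) ≫ S.1.ι = F.map S.1.ι ≫ m := by
    rw [Category.assoc, hf, ← he, Iso.inv_hom_id_assoc]
  refine hrec.hasInitial (e.inv ≫ f) ?_ ?_
  · rw [← cancel_mono S.1.ι, Category.assoc, hk, hc, Category.id_comp]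
  · rw [← cancel_mono (F.map S.1.ι ≫ m), Category.assoc, hc, hk, Category.id_comp]

end PrefixedPoint

/-! ### Initial towers -/

/-- The hit set `{K | K ∩ U ≠ ∅}` commutes with all unions in `U`. The miss set `{K | K ⊆ U}`
commutes only with directed unions of open sets, because the sets `K` are compact. -/
theorem iInf_induced_compacts_le {N X : Type*} {Y : N → Type*} [Nonempty N] [Preorder N]
    [IsDirectedOrder N] [TopologicalSpace X] [tY : ∀ n, TopologicalSpace (Y n)]
    {g : ∀ n, X → Y n} (hg : ∀ n, Continuous (g n))
    (h : ∀ U : Set X, IsOpen U → ∃ V : ∀ n, Set (Y n), (∀ n, IsOpen (V n)) ∧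
      (Monotone fun n => g n ⁻¹' V n) ∧ U = ⋃ n, g n ⁻¹' V n) :
    ⨅ n, (Compacts.topology (α := Y n)).induced (Compacts.map (g n) (hg n)) ≤
      Compacts.topology := by
  have hle (n : N) (O : Set (Compacts (Y n))) (hO : IsOpen O) :
      IsOpen[⨅ n, (Compacts.topology (α := Y n)).induced (Compacts.map (g n) (hg n))]
        (Compacts.map (g n) (hg n) ⁻¹' O) :=
    iInf_le (fun n => (Compacts.topology (α := Y n)).induced (Compacts.map (g n) (hg n))) n _
      ⟨O, hO, rfl⟩
  change _ ≤ TopologicalSpace.induced ((↑) : Compacts X → Set X) (TopologicalSpace.vietoris X)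
  rw [TopologicalSpace.vietoris, induced_generateFrom_eq]
  refine le_generateFrom ?_
  rintro _ ⟨_, ⟨U, hU, rfl⟩ | ⟨U, hU, rfl⟩, rfl⟩
  · obtain ⟨V, hV, hmono, rfl⟩ := h U hU
    have : ((↑) : Compacts X → Set X) ⁻¹' (⋃ n, g n ⁻¹' V n).powerset =
        ⋃ n, Compacts.map (g n) (hg n) ⁻¹' {K : Compacts (Y n) | (K : Set (Y n)) ⊆ V n} := by
      ext K
      simp only [Set.mem_preimage, Set.mem_powerset_iff, Set.mem_iUnion, Set.mem_ofPred_eq,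
        Compacts.coe_map, Set.image_subset_iff]
      exact ⟨fun hK => K.isCompact.elim_directed_cover _ (fun n => (hV n).preimage (hg n)) hK
        hmono.directed_le, fun ⟨n, hn⟩ => hn.trans (Set.subset_iUnion (fun n => g n ⁻¹' V n) n)⟩
    rw [this]
    exact @isOpen_iUnion _ _ (⨅ n, _) _ fun n =>
      hle n _ (Compacts.isOpen_subsets_of_isOpen (hV n))
  · obtain ⟨V, hV, -, rfl⟩ := h U hU
    have : ((↑) : Compacts X → Set X) ⁻¹' {s | (s ∩ ⋃ n, g n ⁻¹' V n).Nonempty} =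
        ⋃ n, Compacts.map (g n) (hg n) ⁻¹'
          {K : Compacts (Y n) | ((K : Set (Y n)) ∩ V n).Nonempty} := by
      ext K
      simp only [Set.mem_preimage, Set.mem_iUnion, Set.mem_ofPred_eq, Compacts.coe_map,
        Set.image_inter_nonempty_iff, Set.inter_iUnion, Set.nonempty_iUnion]
    rw [this]
    exact @isOpen_iUnion _ _ (⨅ n, _) _ fun n =>
      hle n _ (Compacts.isOpen_inter_nonempty_of_isOpen (hV n))

theorem iInf_induced_pi_le {I N : Type*} {Z : I → Type*} {W : I → N → Type*}
    [tZ : ∀ i, TopologicalSpace (Z i)] [tW : ∀ i n, TopologicalSpace (W i n)]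
    {g : ∀ i n, Z i → W i n} (h : ∀ i, ⨅ n, (tW i n).induced (g i n) ≤ tZ i) :
    ⨅ n, (inferInstance : TopologicalSpace (∀ i, W i n)).induced (fun z i => g i n (z i)) ≤
      Pi.topologicalSpace := by
  refine le_iInf fun i => le_trans ?_ (induced_mono (h i))
  rw [induced_iInf]
  refine iInf_mono fun n => ?_
  rw [induced_compose]
  refine (induced_mono (iInf_le _ i)).trans_eq ?_
  rw [induced_compose]
  rfl

theorem iInf_induced_sigma_le {I N : Type*} {Z : I → Type*} {W : I → N → Type*}
    [∀ i, TopologicalSpace (Z i)] [∀ i n, TopologicalSpace (W i n)] {g : ∀ i n, Z i → W i n}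
    (h : ∀ i (U : Set (Z i)), IsOpen U →
      ∃ V : ∀ n, Set (W i n), (∀ n, IsOpen (V n)) ∧ U = ⋃ n, g i n ⁻¹' V n) :
    ⨅ n, (inferInstance : TopologicalSpace (Σ i, W i n)).induced
      (fun z => ⟨z.1, g z.1 n z.2⟩) ≤ (inferInstance : TopologicalSpace (Σ i, Z i)) := by
  intro O hO
  choose V hV hOV using fun i => h i _ (isOpen_sigma_iff.1 hO i)
  have : O = ⋃ n, (fun z : Σ i, Z i => (⟨z.1, g z.1 n z.2⟩ : Σ i, W i n)) ⁻¹'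
      Set.univ.sigma fun i => V i n := by
    ext ⟨i, x⟩
    have hx := Set.ext_iff.1 (hOV i) x
    simpa using hx
  rw [this]
  refine @isOpen_iUnion _ _ (⨅ n, _) _ fun n => ?_
  exact iInf_le (fun n => (inferInstance : TopologicalSpace (Σ i, W i n)).induced _) n _
    ⟨Set.univ.sigma fun i => V i n, isOpen_sigma_iff.2 fun i => by simpa using hV i n, rfl⟩

/-- A sequence of continuous maps `f n : X ⟶ Y n`, each of which factors through all later ones, is
an initial tower if `X` has the initial (coarsest) topology for it. The maps between the `Y n` are
only required to exist, since they play no role beyond making the induced topologies increase. -/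
structure IsInitialTower {X : TopCat.{u}} {Y : ℕ → TopCat.{u}} (f : ∀ n, X ⟶ Y n) : Prop where
  factors : ∀ ⦃m n⦄, m ≤ n → ∃ g : Y n ⟶ Y m, f n ≫ g = f m
  iInf_induced_le : ⨅ n, (Y n).str.induced (f n) ≤ X.str

namespace IsInitialTower

variable {X : TopCat.{u}} {Y : ℕ → TopCat.{u}} {f : ∀ n, X ⟶ Y n}

theorem induced_antitone (hf : IsInitialTower f) : Antitone fun n => (Y n).str.induced (f n) := by
  intro m n hmn
  obtain ⟨g, hg⟩ := hf.factors hmn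
  dsimp only
  rw [← hg]
  exact (induced_mono (continuous_iff_le_induced.1 g.hom.continuous)).trans_eq induced_compose

/-- An open subset of the domain of an initial tower is an increasing union of preimages of open
sets. -/
theorem exists_eq_iUnion (hf : IsInitialTower f) {U : Set X} (hU : IsOpen U) :
    ∃ V : ∀ n, Set (Y n), (∀ n, IsOpen (V n)) ∧ (Monotone fun n => f n ⁻¹' V n) ∧
      U = ⋃ n, f n ⁻¹' V n := by
  -- `V n` is the largest open set with preimage inside `U`.
  refine ⟨fun n => ⋃₀ {V | IsOpen V ∧ f n ⁻¹' V ⊆ U}, fun n => isOpen_sUnion fun V hV => hV.1,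
    fun m n hmn => ?_, subset_antisymm (fun x hx => ?_) ?_⟩
  · obtain ⟨g, hg⟩ := hf.factors hmn
    rintro x ⟨V, ⟨hV, hVU⟩, hx⟩
    have hpre : f n ⁻¹' (g ⁻¹' V) = f m ⁻¹' V := by rw [← hg]; rfl
    exact ⟨g ⁻¹' V, ⟨hV.preimage g.hom.continuous, hpre ▸ hVU⟩,
      show x ∈ f n ⁻¹' (g ⁻¹' V) from hpre ▸ hx⟩
  · have hle : (⨅ n, @nhds X ((Y n).str.induced (f n)) x) ≤ 𝓝 x := by
      exact nhds_iInf.ge.trans (nhds_mono hf.iInf_induced_le)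
    have hdir : Directed (· ≥ ·) fun n => @nhds X ((Y n).str.induced (f n)) x :=
      directed_of_isDirected_le fun m n hmn => nhds_mono (hf.induced_antitone hmn)
    obtain ⟨n, hn⟩ := (Filter.mem_iInf_of_directed hdir U).1 (hle (hU.mem_nhds hx))
    rw [nhds_induced, Filter.mem_comap] at hn
    obtain ⟨W, hW, hWU⟩ := hn
    obtain ⟨V, hVW, hV, hxV⟩ := mem_nhds_iff.1 hW
    exact Set.mem_iUnion.2 ⟨n, V, ⟨hV, (Set.preimage_mono hVW).trans hWU⟩, hxV⟩
  · refine Set.iUnion_subset fun n x => ?_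
    rintro ⟨V, ⟨-, hVU⟩, hx⟩
    exact hVU hx

theorem eq_of_forall_eq [T0Space X] (hf : IsInitialTower f) {x y : X}
    (h : ∀ n, f n x = f n y) : x = y := by
  refine T0Space.t0 (inseparable_iff_forall_isOpen.2 fun U hU => ?_)
  obtain ⟨V, -, -, rfl⟩ := hf.exists_eq_iUnion hU
  simp [h]

theorem map_factors (hf : IsInitialTower f) (F : TopCat.{u} ⥤ TopCat.{u}) ⦃m n : ℕ⦄
    (hmn : m ≤ n) : ∃ g : F.obj (Y n) ⟶ F.obj (Y m), F.map (f n) ≫ g = F.map (f m) := by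
  obtain ⟨g, hg⟩ := hf.factors hmn
  exact ⟨F.map g, by rw [← F.map_comp, hg]⟩

theorem vietoris (hf : IsInitialTower f) :
    IsInitialTower fun n => vietorisFunctor.map (f n) where
  factors := hf.map_factors _
  iInf_induced_le := iInf_induced_compacts_le (fun n => (f n).hom.continuous)
    fun _ => hf.exists_eq_iUnion

theorem const (A : TopCat.{u}) : IsInitialTower fun _ : ℕ => 𝟙 A where
  factors _ _ _ := ⟨𝟙 A, Category.comp_id _⟩
  iInf_induced_le := (iInf_le _ 0).trans_eq induced_id

theorem prod {I : Type u} {F : I → TopCat.{u} ⥤ TopCat.{u}} (hf : IsInitialTower f)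
    (hF : ∀ i, IsInitialTower fun n => (F i).map (f n)) :
    IsInitialTower fun n => (topProdFunctor F).map (f n) where
  factors := hf.map_factors _
  iInf_induced_le := iInf_induced_pi_le (Z := fun i => (F i).obj X)
    (W := fun i n => (F i).obj (Y n)) (g := fun i n => (F i).map (f n))
    fun i => (hF i).iInf_induced_le

theorem coprod {I : Type u} {F : I → TopCat.{u} ⥤ TopCat.{u}} (hf : IsInitialTower f)
    (hF : ∀ i, IsInitialTower fun n => (F i).map (f n)) :
    IsInitialTower fun n => (topCoprodFunctor F).map (f n) where
  factors := hf.map_factors _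
  iInf_induced_le := iInf_induced_sigma_le (Z := fun i => (F i).obj X)
    (W := fun i n => (F i).obj (Y n)) (g := fun i n => (F i).map (f n)) fun i _ hU =>
    let ⟨V, hV, _, hUV⟩ := (hF i).exists_eq_iUnion hU
    ⟨V, hV, hUV⟩

end IsInitialTower

/-! ### The limit of the terminal chain -/

section TerminalChain

variable (F : TopCat.{u} ⥤ TopCat.{u})

/-- The spaces `1, F 1, F (F 1), …` of the terminal chain of `F`. -/
def terminalChain : ℕ → TopCat.{u}
  | 0 => TopCat.of PUnit
  | n + 1 => F.obj (terminalChain n)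

/-- The connecting maps of the terminal chain. -/
def terminalChainMap : ∀ n, terminalChain F (n + 1) ⟶ terminalChain F n
  | 0 => TopCat.ofHom ⟨fun _ => PUnit.unit, continuous_const⟩
  | n + 1 => F.map (terminalChainMap n)

/-- The limit of the terminal chain, as a space of compatible sequences. -/
def terminalChainLimit : TopCat.{u} :=
  TopCat.of {x : ∀ n, terminalChain F n // ∀ n, terminalChainMap F n (x (n + 1)) = x n}

/-- The projections of the limit of the terminal chain. -/
def terminalChainProj (n : ℕ) : terminalChainLimit F ⟶ terminalChain F n :=
  TopCat.ofHom ⟨fun x => x.1 n, (continuous_apply n).comp continuous_subtype_val⟩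

theorem terminalChainProj_comp (n : ℕ) :
    terminalChainProj F (n + 1) ≫ terminalChainMap F n = terminalChainProj F n :=
  TopCat.hom_ext (ContinuousMap.ext fun x => x.2 n)

theorem isInitialTower_terminalChainProj : IsInitialTower (terminalChainProj F) where
  factors m n hmn := by
    induction n, hmn using Nat.le_induction with
    | base => exact ⟨𝟙 _, Category.comp_id _⟩
    | succ n _ ih =>
      obtain ⟨g, hg⟩ := ih
      exact ⟨terminalChainMap F n ≫ g, by rw [← Category.assoc, terminalChainProj_comp, hg]⟩
  iInf_induced_le := by
    refine le_trans ?_ induced_iInf.ge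
    exact iInf_mono fun n => induced_compose.ge

/-- The coordinates of the canonical map from `F L` to the limit `L` of the terminal chain. -/
def terminalChainLimitStrAux : ∀ n, F.obj (terminalChainLimit F) ⟶ terminalChain F n
  | 0 => TopCat.ofHom ⟨fun _ => PUnit.unit, continuous_const⟩
  | n + 1 => F.map (terminalChainProj F n)

theorem terminalChainLimitStrAux_comp :
    ∀ n, terminalChainLimitStrAux F (n + 1) ≫ terminalChainMap F n = terminalChainLimitStrAux F n
  | 0 => rfl
  | n + 1 => by
    change F.map (terminalChainProj F (n + 1)) ≫ F.map (terminalChainMap F n) = _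
    rw [← F.map_comp, terminalChainProj_comp]
    rfl

/-- The canonical map from `F L` to the limit `L` of the terminal chain. -/
def terminalChainLimitStr : F.obj (terminalChainLimit F) ⟶ terminalChainLimit F :=
  TopCat.ofHom
    ⟨fun x => ⟨fun n => terminalChainLimitStrAux F n x, fun n =>
        ConcreteCategory.congr_hom (terminalChainLimitStrAux_comp F n) x⟩,
      (continuous_pi fun n => (terminalChainLimitStrAux F n).hom.continuous).subtype_mk _⟩

variable {F}

theorem t2Space_terminalChainLimit (hF : ∀ X : TopCat.{u}, T2Space X → T2Space (F.obj X)) :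
    T2Space (terminalChainLimit F) := by
  have (n : ℕ) : T2Space (terminalChain F n) := by
    induction n with
    | zero => exact inferInstanceAs (T2Space PUnit)
    | succ n ih => exact hF _ ih
  exact inferInstanceAs
    (T2Space {x : ∀ n, terminalChain F n // ∀ n, terminalChainMap F n (x (n + 1)) = x n})

/-- If `F` preserves Hausdorff spaces and initial towers, then the limit of its terminal chain is a
pre-fixed point. -/
theorem mono_terminalChainLimitStr (hF : ∀ X : TopCat.{u}, T2Space X → T2Space (F.obj X))
    (hF' : ∀ {X : TopCat.{u}} {Y : ℕ → TopCat.{u}} {f : ∀ n, X ⟶ Y n}, IsInitialTower f →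
      IsInitialTower fun n => F.map (f n)) : Mono (terminalChainLimitStr F) := by
  have := hF _ (t2Space_terminalChainLimit hF)
  refine (TopCat.mono_iff_injective _).2 fun x y hxy => ?_
  exact (hF' (isInitialTower_terminalChainProj F)).eq_of_forall_eq fun n =>
    congrFun (congrArg Subtype.val hxy) (n + 1)

end TerminalChain

/-! ### Vietoris polynomial functors -/

namespace VietorisExpr

theorem t2Space_obj (e : VietorisExpr.{u}) (he : e.HausdorffConstants) (X : TopCat.{u})
    (hX : T2Space X) : T2Space (e.toFunctor.obj X) := by
  induction e generalizing X with
  | vietoris => exact inferInstanceAs (T2Space (Compacts X))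
  | const A => exact he
  | ident => exact hX
  | prod I F ih =>
    have (i : I) := ih i (he i) X hX
    exact inferInstanceAs (T2Space (∀ i, (F i).toFunctor.obj X))
  | coprod I F ih =>
    have (i : I) := ih i (he i) X hX
    exact inferInstanceAs (T2Space (Σ i, (F i).toFunctor.obj X))
  | comp F G ihF ihG => exact ihF he.1 _ (ihG he.2 X hX)

theorem map_injective (e : VietorisExpr.{u}) {X Y : TopCat.{u}} (f : X ⟶ Y) (hf : Injective f) :
    Injective (e.toFunctor.map f) := by
  induction e generalizing X Y with
  | vietoris => exact Compacts.map_injective f.hom.continuous hf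
  | const A => exact injective_id
  | ident => exact hf
  | prod I F ih => exact fun x y h => funext fun i => ih i f hf (congrFun h i)
  | coprod I F ih =>
    exact Function.Injective.sigma_map (f₁ := id) (β₁ := fun i => (F i).toFunctor.obj X)
      (β₂ := fun i => (F i).toFunctor.obj Y) (f₂ := fun i => (F i).toFunctor.map f)
      injective_id fun i => ih i f hf
  | comp F G ihF ihG => exact ihF _ (ihG f hf)

instance (e : VietorisExpr.{u}) : e.toFunctor.PreservesMonomorphisms where
  preserves f _ := (TopCat.mono_iff_injective _).2
    (e.map_injective f ((TopCat.mono_iff_injective f).1 inferInstance))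

theorem isInitialTower_map (e : VietorisExpr.{u}) {X : TopCat.{u}} {Y : ℕ → TopCat.{u}}
    {f : ∀ n, X ⟶ Y n} (hf : IsInitialTower f) :
    IsInitialTower fun n => e.toFunctor.map (f n) := by
  induction e generalizing X Y with
  | vietoris => exact hf.vietoris
  | const A => exact .const A
  | ident => exact hf
  | prod I F ih => exact hf.prod fun i => ih i hf
  | coprod I F ih => exact hf.coprod fun i => ih i hf
  | comp F G ihF ihG => exact ihF (ihG hf)

end VietorisExpr

theorem mainTheorem10 (e : VietorisExpr.{u}) (he : e.HausdorffConstants)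
    (F : TopCat.{u} ⥤ TopCat.{u}) (hF : Nonempty (F ≅ e.toFunctor)) :
    HasInitial (Endofunctor.Algebra F) := by
  obtain ⟨α⟩ := hF
  have := mono_terminalChainLimitStr (e.t2Space_obj he) e.isInitialTower_map
  have := hasInitial_algebra_of_mono (terminalChainLimitStr e.toFunctor)
  exact (Endofunctor.Algebra.equivOfNatIso α).hasInitial_iff.2 this
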